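/- Let $T$ be a complete first-order theory with NIP: for no formula $\varphi(x,y)$ are there, in models of $T$, arbitrarily large finite sets $A$ of $x$-tuples such that every subset of $A$ has the form $\{a\in A:\ \models\varphi(a,b)\}$ for some $b$. Let $\bar M$ be a monster model of $T$: for some uncountable cardinal $\kappa$ larger than the size of the language, $\bar M$ is $\kappa$-saturated and strongly $\kappa$-homogeneous, and "small" means of cardinality less than $\kappa$. Let $M\preceq\bar M$ be a small elementary submodel. Let $X,Y$ be definable sets in sorts of $\bar M^{eq}$ and let $\varphi(x,y)\subseteq X\times Y$ be a formula over $M$. A global (Keisler) measure on $X^{m}$ is a finitely additive probability measure $\mu$ on the definable (with parameters in $\bar M$) sets in the variables $(x_1,\dots,x_m)$, each of the sort of $X$, with $\mu(x_i\in X)=1$ for all $i$. It is symmetric if $\mu(\psi(x_1,\dots,x_m))=\mu(\psi(x_{\sigma(1)},\dots,x_{\sigma(m)}))$ for every formula $\psi$ over $\bar M$ and every permutation $\sigma$ of $\{1,\dots,m\}$, and $M$-invariant if it is unchanged by every automorphism of $\bar M$ fixing $M$ pointwise. For each $n>0$ let $\mu_n$ be any symmetric, $M$-invariant global measure on $X^{2n}$.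 For $a=(a_1,\dots,a_n)$, $a'=(a_1',\dots,a_n')$ in $X^n$ put $$\mathrm{Fr}(\varphi(x,b);a)=\tfrac1n\,\bigl|\{i:\ \models\varphi(a_i,b)\}\bigr|,\qquad \delta(a,a')=\sup_{b\in\bar M}\bigl|\mathrm{Fr}(\varphi(x,b);a)-\mathrm{Fr}(\varphi(x,b);a')\bigr|,$$ where $b$ ranges over the elements of $\bar M^{eq}$ of the sort of $y$. Then, for each $n>0$, the function $\delta$ takes finitely many values and each of its level sets is definable, so that it has a $\mu_n$-expectation $E(n)=\sum_{r} r\,\mu_n(\delta=r)$, and $$\lim_{n\to\infty}E(n)=0.$$ -/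

import Mathlib

open FirstOrder FirstOrder.Language

universe u v w

/-! ### Theories without the independence property, and monster models -/

/-- The theory `T` has the independence property: for some `L`-formula `φ(x, y)` (with `x`, `y`
finite tuples of variables) there are, in models of `T`, arbitrarily large finite sets `A` of
`x`-tuples such that every subset `B` of `A` has the form `{a ∈ A : φ(a, b)}` for some `b`. -/
def FirstOrder.Language.Theory.HasIP {L : FirstOrder.Language.{u, v}} (T : L.Theory) : Prop :=
  ∃ (m k : ℕ) (φ : L.Formula (Fin m ⊕ Fin k)), ∀ n : ℕ,
    ∃ (N : Theory.ModelType.{u, v, w} T) (A : Finset (Fin m → N)), n ≤ A.card ∧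
      ∀ B ⊆ A, ∃ b : Fin k → N, ∀ a ∈ A, a ∈ B ↔ φ.Realize (Sum.elim a b)

/-- The theory `T` is NIP: no formula has the independence property. -/
def FirstOrder.Language.Theory.IsNIP {L : FirstOrder.Language.{u, v}} (T : L.Theory) : Prop :=
  ¬ Theory.HasIP.{u, v, w} T

/-- `U` is `κ`-saturated: every finitely satisfiable set of formulas in finitely many variables
over a parameter set of size less than `κ` is realized in `U`. -/
def IsSaturatedModel (L : FirstOrder.Language.{u, v}) (U : Type w) [L.Structure U]
    (κ : Cardinal.{w}) : Prop :=
  ∀ A : Set U, Cardinal.mk A < κ → ∀ (n : ℕ) (p : Set (L[[A]].Formula (Fin n))),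
    (∀ s : Finset (L[[A]].Formula (Fin n)), (s : Set (L[[A]].Formula (Fin n))) ⊆ p →
      ∃ v : Fin n → U, ∀ φ ∈ s, φ.Realize v) →
    ∃ v : Fin n → U, ∀ φ ∈ p, φ.Realize v

/-- `U` is strongly `κ`-homogeneous: every partial elementary map from a subset of size less than
`κ` into `U` extends to an automorphism of `U`. -/
def IsStronglyHomogeneous (L : FirstOrder.Language.{u, v}) (U : Type w) [L.Structure U]
    (κ : Cardinal.{w}) : Prop :=
  ∀ A : Set U, Cardinal.mk A < κ → ∀ f : A → U,
    (∀ (n : ℕ) (φ : L.Formula (Fin n)) (v : Fin n → A),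
      φ.Realize (fun i => f (v i)) ↔ φ.Realize (fun i => (v i : U))) →
    ∃ σ : U ≃[L] U, ∀ a : A, σ (a : U) = f a

/-- `U` is a monster model (universal domain) with respect to `κ`; the small subsets of `U` are
those of cardinality less than `κ`. -/
structure IsMonsterModel (L : FirstOrder.Language.{u, v}) (U : Type w) [L.Structure U]
    (κ : Cardinal.{w}) : Prop where
  aleph0_lt : Cardinal.aleph0 < κ
  card_lt : Cardinal.lift.{w} L.card < Cardinal.lift.{max u v} κ
  saturated : IsSaturatedModel L U κ
  homogeneous : IsStronglyHomogeneous L U κ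

/-! ### Sorts of `U^eq` and their definable sets -/

/-- A sort of `U^eq`: a `∅`-definable equivalence relation on a finite Cartesian power of `U`.
The sort of real `n`-tuples is given by equality. A finite tuple of sorts is again a sort. -/
structure EqSort (L : FirstOrder.Language.{u, v}) (U : Type w) [L.Structure U] where
  arity : ℕ
  rel : Setoid (Fin arity → U)
  definable_rel : (∅ : Set U).Definable L
    {v : Fin arity ⊕ Fin arity → U | rel (fun i => v (Sum.inl i)) (fun i => v (Sum.inr i))}

namespace EqSort

variable {L : FirstOrder.Language.{u, v}} {U : Type w} [L.Structure U]

/-- The elements of a sort of `U^eq`. -/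
def Carrier (S : EqSort L U) : Type w := Quotient S.rel

/-- The element of the sort `S` represented by a tuple of `U`. -/
def cls (S : EqSort L U) (v : Fin S.arity → U) : S.Carrier := Quotient.mk S.rel v

/-- A subset of `S^ι` is definable over `A` when its pullback to representatives is. -/
def IsDefinable (S : EqSort L U) (A : Set U) {ι : Type} (D : Set (ι → S.Carrier)) : Prop :=
  A.Definable L {v : ι × Fin S.arity → U | (fun i => S.cls fun j => v (i, j)) ∈ D}

/-- A subset of the sort `S` is definable over `A` when its pullback to representatives is. -/
def IsDefinable₁ (S : EqSort L U) (A : Set U) (X : Set S.Carrier) : Prop :=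
  A.Definable L {v : Fin S.arity → U | S.cls v ∈ X}

/-- A relation between the sorts `S` and `S'` is definable over `A` (that is, it is given by a
formula `φ(x, y)` over `A` with `x` of sort `S` and `y` of sort `S'`) when its pullback to
representatives is. -/
def IsDefinable₂ (S S' : EqSort L U) (A : Set U) (Φ : Set (S.Carrier × S'.Carrier)) : Prop :=
  A.Definable L {v : Fin S.arity ⊕ Fin S'.arity → U |
    (S.cls fun i => v (Sum.inl i), S'.cls fun j => v (Sum.inr j)) ∈ Φ}

theorem rel_map (S : EqSort L U) (σ : U ≃[L] U) {a b : Fin S.arity → U} (h : S.rel a b) :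
    S.rel (fun i => σ (a i)) (fun i => σ (b i)) := by
  obtain ⟨φ, hφ⟩ := Set.empty_definable_iff.1 S.definable_rel
  have key : ∀ c d : Fin S.arity → U, S.rel c d ↔ φ.Realize (Sum.elim c d) := fun c d => by
    have := Set.ext_iff.1 hφ (Sum.elim c d)
    simpa using this
  rw [key] at h ⊢
  rw [← StrongHomClass.realize_formula σ φ] at h
  convert h using 1
  funext x
  cases x <;> rfl

/-- The action of an automorphism of `U` on a sort of `U^eq`. -/
def map (S : EqSort L U) (σ : U ≃[L] U) : S.Carrier → S.Carrier :=
  Quotient.map (fun a i => σ (a i)) fun _ _ h => S.rel_map σ h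

theorem isDefinable_univ (S : EqSort L U) (ι : Type) :
    S.IsDefinable Set.univ (Set.univ : Set (ι → S.Carrier)) :=
  Set.definable_univ

theorem IsDefinable.union {S : EqSort L U} {ι : Type} {A : Set U} {D E : Set (ι → S.Carrier)}
    (hD : S.IsDefinable A D) (hE : S.IsDefinable A E) : S.IsDefinable A (D ∪ E) :=
  Set.Definable.union hD hE

theorem IsDefinable.perm {S : EqSort L U} {ι : Type} {A : Set U} {D : Set (ι → S.Carrier)}
    (hD : S.IsDefinable A D) (σ : Equiv.Perm ι) :
    S.IsDefinable A {a : ι → S.Carrier | (fun i => a (σ i)) ∈ D} :=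
  Set.Definable.preimage_comp (fun p : ι × Fin S.arity => (σ p.1, p.2)) hD

theorem IsDefinable.coord {S : EqSort L U} {ι : Type} {A : Set U} {X : Set S.Carrier}
    (hX : S.IsDefinable₁ A X) (i : ι) : S.IsDefinable A {a : ι → S.Carrier | a i ∈ X} :=
  Set.Definable.preimage_comp (fun j : Fin S.arity => (i, j)) hX

theorem IsDefinable.aut {S : EqSort L U} {ι : Type} {D : Set (ι → S.Carrier)}
    (hD : S.IsDefinable Set.univ D) (σ : U ≃[L] U) :
    S.IsDefinable Set.univ {a : ι → S.Carrier | (fun i => S.map σ (a i)) ∈ D} := by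
  unfold IsDefinable at hD ⊢
  rw [Set.definable_iff_exists_formula_sum] at hD ⊢
  obtain ⟨φ, hφ⟩ := hD
  refine ⟨φ.relabel (Sum.map (fun c => ⟨σ.symm c.1, trivial⟩) id), ?_⟩
  ext v
  have h1 := Set.ext_iff.1 hφ (fun p => σ (v p))
  simp only [Set.mem_ofPred_eq] at h1 ⊢
  rw [Formula.realize_relabel, ← StrongHomClass.realize_formula σ φ]
  refine Iff.trans h1 (iff_of_eq (congrArg φ.Realize ?_))
  funext x
  cases x <;> simp

end EqSort

/-! ### Keisler measures -/

/-- The definable (with parameters in `U`) subsets of `S^ι`. -/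
def DefSet {L : FirstOrder.Language.{u, v}} {U : Type w} [L.Structure U] (S : EqSort L U) (ι : Type) :
    Type w :=
  {D : Set (ι → S.Carrier) // S.IsDefinable Set.univ D}

/-- A global Keisler measure in variables `(x_i)_{i ∈ ι}` of sort `S`: a finitely additive
probability measure on the Boolean algebra of definable subsets of `S^ι`. -/
structure KeislerMeasure {L : FirstOrder.Language.{u, v}} {U : Type w} [L.Structure U]
    (S : EqSort L U) (ι : Type) where
  toFun : DefSet S ι → ℝ
  nonneg : ∀ D, 0 ≤ toFun D
  total : toFun ⟨Set.univ, S.isDefinable_univ ι⟩ = 1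
  additive : ∀ D E : DefSet S ι, Disjoint D.1 E.1 →
    toFun ⟨D.1 ∪ E.1, D.2.union E.2⟩ = toFun D + toFun E

namespace KeislerMeasure

variable {L : FirstOrder.Language.{u, v}} {U : Type w} [L.Structure U] {S : EqSort L U} {ι : Type}

/-- `μ` is a symmetric measure on `X^ι`: it gives measure one to each `x_i ∈ X`, and it is
unchanged by every permutation of the variables. -/
def IsSymmetricOn (μ : KeislerMeasure S ι) (X : Set S.Carrier)
    (hX : S.IsDefinable₁ Set.univ X) : Prop :=
  (∀ i : ι, μ.toFun ⟨{a | a i ∈ X}, EqSort.IsDefinable.coord hX i⟩ = 1) ∧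
  ∀ (σ : Equiv.Perm ι) (D : DefSet S ι),
    μ.toFun ⟨{a | (fun i => a (σ i)) ∈ D.1}, D.2.perm σ⟩ = μ.toFun D

/-- `μ` is `A`-invariant: it is unchanged by every automorphism of `U` that fixes `A`
pointwise. -/
def IsInvariant (μ : KeislerMeasure S ι) (A : Set U) : Prop :=
  ∀ σ : U ≃[L] U, (∀ a ∈ A, σ a = a) → ∀ D : DefSet S ι,
    μ.toFun ⟨{a | (fun i => S.map σ (a i)) ∈ D.1}, D.2.aut σ⟩ = μ.toFun D

/-- `F` is a definable simple function on `S^ι` (it has finitely many values, and its level sets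
are definable), and `e = ∑ r, r * μ (F = r)` is its `μ`-expectation. -/
def HasExpectation (μ : KeislerMeasure S ι) (F : (ι → S.Carrier) → ℝ) (e : ℝ) : Prop :=
  ∃ (hfin : (Set.range F).Finite)
    (hdef : ∀ r : ℝ, S.IsDefinable Set.univ {a : ι → S.Carrier | F a = r}),
    e = ∑ r ∈ hfin.toFinset, r * μ.toFun ⟨{a | F a = r}, hdef r⟩

end KeislerMeasure

/-! ### Frequencies -/

/-- `Fr(P; a_1, …, a_n)`, the proportion of the `i` with `a_i ∈ P`. -/
noncomputable def Fr {C : Type*} (P : Set C) {n : ℕ} (a : Fin n → C) : ℝ :=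
  (Set.ncard {i : Fin n | a i ∈ P} : ℝ) / n

/-- `δ₀(a, a'; b) = |Fr(φ(x, b); a) - Fr(φ(x, b); a')|`. -/
noncomputable def delta₀ {C C' : Type*} (Φ : Set (C × C')) {n : ℕ} (a a' : Fin n → C)
    (b : C') : ℝ :=
  |Fr {x | (x, b) ∈ Φ} a - Fr {x | (x, b) ∈ Φ} a'|

/-- `δ(a, a') = sup_b δ₀(a, a'; b)`, the supremum over all `b` of the sort of `y`. -/
noncomputable def delta {C C' : Type*} (Φ : Set (C × C')) {n : ℕ} (a a' : Fin n → C) : ℝ :=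
  ⨆ b : C', delta₀ Φ a a' b

/-!
The argument is the symmetrization proof of the Vapnik–Chervonenkis theorem.

For a `2n`-tuple `c`, the value `δ(c)` depends only on the finite set of traces
`{i | φ(c i, b)}` of the fibres of `φ` on `c`. That a given set of indices is a trace is a definable
condition on `c`, so `δ` has finitely many values and definable level sets
(`KeislerMeasure.exists_hasExpectation_delta`). By NIP the system of traces has VC dimension at
most some `d` independent of `n` (`EqSort.exists_vcDim_le`), and by the Sauer–Shelah lemma there are
only polynomially many traces (`Finset.card_le_of_vcDim_le`).

A symmetric measure does not see the exchange of `x_i` and `x'_i` for an arbitrary set of `i`, so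
`E(n)` is at most the largest average of `δ` over the `2 ^ n` such exchanges applied to one fixed
tuple `c` (`KeislerMeasure.HasExpectation.le_of_average_le`). For fixed `c` this is the average, over
random signs, of the maximum of `|∑ ± x_i| / n` over polynomially many vectors `x` with entries in
`{-1, 0, 1}`. The exponential moment bound `sum_exp_signs_le` controls that maximum
(`sum_max_signs_le`): for every `t > 0` the average is at most `O(log n) / (t n) + t / 2`, and the
limit of `E(n)` follows on letting `n` tend to infinity and then `t` to zero.
-/

/-! ### Expectations of definable simple functions -/

namespace KeislerMeasure

variable {L : FirstOrder.Language.{u, v}} {U : Type w} [L.Structure U] {S : EqSort L U} {ι : Type}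

theorem toFun_congr (μ : KeislerMeasure S ι) {D E : Set (ι → S.Carrier)}
    (hD : S.IsDefinable Set.univ D) (hE : S.IsDefinable Set.univ E) (h : D = E) :
    μ.toFun ⟨D, hD⟩ = μ.toFun ⟨E, hE⟩ := by
  subst h; rfl

theorem toFun_eq_zero (μ : KeislerMeasure S ι) {D : Set (ι → S.Carrier)}
    (hD : S.IsDefinable Set.univ D) (h : D = ∅) : μ.toFun ⟨D, hD⟩ = 0 := by
  have h1 := μ.additive ⟨D, hD⟩ ⟨D, hD⟩ (by simp [h])
  have h2 := μ.toFun_congr (hD.union hD) hD (Set.union_self D)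
  simp only at h1
  linarith

theorem _root_.EqSort.isDefinable_mem_finset {β : Type*} {K : (ι → S.Carrier) → β}
    (hK : ∀ w, S.IsDefinable Set.univ {a | K a = w}) (s : Finset β) :
    S.IsDefinable Set.univ {a | K a ∈ s} := by
  classical
  have h := Set.definable_biUnion_finset hK s
  unfold EqSort.IsDefinable
  convert! h using 1
  ext; simp

/-- Finite additivity for the fibres of a map with definable fibres. -/
theorem toFun_mem_finset (μ : KeislerMeasure S ι) {β : Type*} {K : (ι → S.Carrier) → β}
    (hK : ∀ w, S.IsDefinable Set.univ {a | K a = w}) (s : Finset β)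
    (hs : S.IsDefinable Set.univ {a | K a ∈ s}) :
    μ.toFun ⟨{a | K a ∈ s}, hs⟩ = ∑ w ∈ s, μ.toFun ⟨{a | K a = w}, hK w⟩ := by
  classical
  induction s using Finset.induction_on with
  | empty => exact μ.toFun_eq_zero hs (by simp)
  | insert b s hb ih =>
    have hs' := EqSort.isDefinable_mem_finset hK s
    rw [Finset.sum_insert hb, ← ih hs',
      ← μ.additive ⟨_, hK b⟩ ⟨_, hs'⟩ (Set.disjoint_left.2 fun a ha ha' => hb (ha ▸ ha'))]
    exact μ.toFun_congr _ _ (by ext; simp)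

/-- The expectation of a function `g ∘ K` that factors through a map `K` with finitely many values
and definable fibres is computed on the fibres of `K`. -/
theorem HasExpectation.eq_sum {μ : KeislerMeasure S ι} {F : (ι → S.Carrier) → ℝ} {e : ℝ}
    (h : μ.HasExpectation F e) {β : Type*} {K : (ι → S.Carrier) → β}
    (hfin : (Set.range K).Finite) (hK : ∀ w, S.IsDefinable Set.univ {a | K a = w})
    {g : β → ℝ} (hF : ∀ a, F a = g (K a)) :
    e = ∑ w ∈ hfin.toFinset, g w * μ.toFun ⟨{a | K a = w}, hK w⟩ := by
  classical
  obtain ⟨hF', hdef, rfl⟩ := h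
  have key : ∀ r, μ.toFun ⟨{a | F a = r}, hdef r⟩ =
      ∑ w ∈ hfin.toFinset with g w = r, μ.toFun ⟨{a | K a = w}, hK w⟩ := fun r => by
    rw [← μ.toFun_mem_finset hK _ (EqSort.isDefinable_mem_finset hK _)]
    exact μ.toFun_congr _ _ (by ext; simp [hF])
  rw [← Finset.sum_fiberwise_of_maps_to (s := hfin.toFinset) (t := hF'.toFinset) (g := g)
    (by intro w hw; obtain ⟨a, rfl⟩ := by simpa using hw
        simpa using ⟨a, hF a⟩)]
  refine Finset.sum_congr rfl fun r _ => ?_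
  rw [key, Finset.mul_sum]
  exact Finset.sum_congr rfl fun w hw => by rw [(Finset.mem_filter.1 hw).2]

/-- A symmetric measure gives a function and its composite with a permutation of the variables the
same expectation. -/
theorem HasExpectation.perm {μ : KeislerMeasure S ι} {F : (ι → S.Carrier) → ℝ} {e : ℝ}
    (h : μ.HasExpectation F e) (σ : Equiv.Perm ι)
    (hσ : ∀ D : DefSet S ι, μ.toFun ⟨{a | (fun i => a (σ i)) ∈ D.1}, D.2.perm σ⟩ = μ.toFun D) :
    μ.HasExpectation (fun a => F fun i => a (σ i)) e := by
  obtain ⟨hfin, hdef, rfl⟩ := h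
  have hr : Set.range (fun a : ι → S.Carrier => F fun i => a (σ i)) = Set.range F :=
    by
      ext r
      constructor
      · rintro ⟨a, rfl⟩; exact ⟨_, rfl⟩
      · rintro ⟨a, rfl⟩; exact ⟨fun i => a (σ.symm i), by simp⟩
  refine ⟨hr ▸ hfin, fun r => (hdef r).perm σ, ?_⟩
  refine Finset.sum_congr (by ext; simp [hr]) fun r _ => ?_
  rw [← hσ ⟨_, hdef r⟩]
  rfl

/-- If the average of `F` over a finite family of permutations of the variables is everywhere at
most `B`, then so is the expectation of `F` for a symmetric measure. -/
theorem HasExpectation.le_of_average_le {μ : KeislerMeasure S ι} {F : (ι → S.Carrier) → ℝ}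
    {e B : ℝ} (h : μ.HasExpectation F e)
    (hμ : ∀ (σ : Equiv.Perm ι) (D : DefSet S ι),
      μ.toFun ⟨{a | (fun i => a (σ i)) ∈ D.1}, D.2.perm σ⟩ = μ.toFun D)
    {G : Type} [Fintype G] [Nonempty G] (σ : G → Equiv.Perm ι)
    (hB : ∀ a : ι → S.Carrier, ∑ g, F (fun i => a (σ g i)) ≤ Fintype.card G * B) : e ≤ B := by
  classical
  -- All the functions `F ∘ σ g` factor through the joint map `K`.
  let K : (ι → S.Carrier) → G → ℝ := fun a g => F fun i => a (σ g i)
  have hg := fun g => h.perm (σ g) (hμ (σ g))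
  have hfin : (Set.range K).Finite := by
    refine (Set.Finite.pi' fun _ : G => h.1).subset ?_
    rintro _ ⟨a, rfl⟩ g
    exact ⟨_, rfl⟩
  have hK : ∀ w, S.IsDefinable Set.univ {a | K a = w} := fun w => by
    have := Set.definable_iInter_of_finite fun g => (hg g).2.1 (w g)
    unfold EqSort.IsDefinable
    convert! this using 1
    ext v
    simp [K, funext_iff]
  have h1 : (Fintype.card G : ℝ) * e =
      ∑ w ∈ hfin.toFinset, (∑ g, w g) * μ.toFun ⟨{a | K a = w}, hK w⟩ := by
    simp_rw [Finset.sum_mul]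
    rw [Finset.sum_comm, ← nsmul_eq_mul, ← Finset.card_univ, ← Finset.sum_const]
    exact Finset.sum_congr rfl fun g _ => (hg g).eq_sum hfin hK (g := fun w => w g) fun _ => rfl
  have h2 : ∑ w ∈ hfin.toFinset, μ.toFun ⟨{a | K a = w}, hK w⟩ = 1 := by
    rw [← μ.toFun_mem_finset hK _ (EqSort.isDefinable_mem_finset hK _), ← μ.total]
    exact μ.toFun_congr _ _ (by ext; simp)
  have h3 : (Fintype.card G : ℝ) * e ≤ Fintype.card G * B := by
    rw [h1, ← mul_one (_ * B), ← h2, Finset.mul_sum]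
    refine Finset.sum_le_sum fun w hw => mul_le_mul_of_nonneg_right ?_ (μ.nonneg _)
    obtain ⟨a, rfl⟩ := by simpa using hw
    exact hB a
  exact le_of_mul_le_mul_left h3 (by exact_mod_cast Fintype.card_pos)

end KeislerMeasure

/-! ### A maximal inequality for random signs -/

/-- The sign `1` or `-1` encoded by a Boolean, `true` being `1`. -/
noncomputable def boolSign (b : Bool) : ℝ := if b then 1 else -1

/-- The moment generating function of a sum of random signs, by independence and
`cosh s ≤ exp (s ^ 2 / 2)`. -/
theorem sum_exp_signs_le {n : ℕ} (x : Fin n → ℝ) (hx : ∀ i, |x i| ≤ 1) (t : ℝ) :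
    ∑ ε : Fin n → Bool, Real.exp (t * ∑ i, boolSign (ε i) * x i) ≤
      2 ^ n * Real.exp (t ^ 2 * n / 2) := by
  have h : ∀ i, ∑ b : Bool, Real.exp (t * (boolSign b * x i)) ≤ 2 * Real.exp (t ^ 2 / 2) := by
    intro i
    have h1 := Real.cosh_le_exp_half_sq (t * x i)
    have h2 : Real.exp ((t * x i) ^ 2 / 2) ≤ Real.exp (t ^ 2 / 2) := by
      have := (sq_le_one_iff_abs_le_one (x i)).2 (hx i)
      rw [Real.exp_le_exp, mul_pow]
      nlinarith [sq_nonneg t]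
    rw [Real.cosh_eq] at h1
    simp only [boolSign, Fintype.sum_bool, if_true, Bool.false_eq_true, if_false]
    rw [one_mul, neg_one_mul, mul_neg]
    linarith
  calc ∑ ε : Fin n → Bool, Real.exp (t * ∑ i, boolSign (ε i) * x i)
      = ∏ i, ∑ b : Bool, Real.exp (t * (boolSign b * x i)) := by
        rw [Fintype.prod_sum]
        exact Finset.sum_congr rfl fun ε _ => by rw [Finset.mul_sum, Real.exp_sum]
    _ ≤ ∏ _i : Fin n, 2 * Real.exp (t ^ 2 / 2) :=
        Finset.prod_le_prod (fun i _ => by positivity) fun i _ => h i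
    _ = 2 ^ n * Real.exp (t ^ 2 * n / 2) := by
        rw [Finset.prod_const, Finset.card_univ, Fintype.card_fin, mul_pow, ← Real.exp_nat_mul]
        ring_nf

/-- Massart's bound for the average, over all `2 ^ n` choices of signs, of the maximum of
`|∑ ± x_i|` over a finite set of at most `N` vectors `x`; here `f` stands for the maximum, and `t` is
a free parameter. -/
theorem sum_max_signs_le {n : ℕ} (A : Finset (Fin n → ℝ)) (hA : ∀ x ∈ A, ∀ i, |x i| ≤ 1)
    {N : ℝ} (hN : 0 < N) (hAN : (A.card : ℝ) ≤ N) (f : (Fin n → Bool) → ℝ)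
    (hf : ∀ ε, ∃ x ∈ A, f ε ≤ |∑ i, boolSign (ε i) * x i|) {t : ℝ} (ht : 0 < t) :
    t * ∑ ε, f ε ≤ 2 ^ n * (Real.log (2 * N) + t ^ 2 * n / 2) := by
  set k : ℝ := 2 * N * Real.exp (t ^ 2 * n / 2) with hk
  have hk0 : 0 < k := by positivity
  have hlog : Real.log k = Real.log (2 * N) + t ^ 2 * n / 2 := by
    rw [hk, Real.log_mul (by positivity) (by positivity), Real.log_exp]
  have hpt : ∀ ε, t * f ε ≤ Real.log k - 1 +
      (∑ x ∈ A, (Real.exp (t * ∑ i, boolSign (ε i) * x i) +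
        Real.exp (-t * ∑ i, boolSign (ε i) * x i))) / k := by
    intro ε
    obtain ⟨x, hx, hfx⟩ := hf ε
    -- the tangent line of `exp` at `log k`
    have h1 := Real.add_one_le_exp (t * f ε - Real.log k)
    rw [Real.exp_sub, Real.exp_log hk0] at h1
    have h2 : Real.exp (t * f ε) ≤ ∑ x ∈ A, (Real.exp (t * ∑ i, boolSign (ε i) * x i) +
        Real.exp (-t * ∑ i, boolSign (ε i) * x i)) := by
      refine le_trans ?_ (Finset.single_le_sum (fun y _ => by positivity) hx)
      refine (Real.exp_le_exp.2 (mul_le_mul_of_nonneg_left hfx ht.le)).trans ?_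
      rcases abs_choice (∑ i, boolSign (ε i) * x i) with h | h <;> rw [h]
      · linarith [Real.exp_pos (-t * ∑ i, boolSign (ε i) * x i)]
      · rw [mul_neg, ← neg_mul]
        linarith [Real.exp_pos (t * ∑ i, boolSign (ε i) * x i)]
    have h3 := div_le_div_of_nonneg_right h2 hk0.le
    linarith
  have hsum : ∑ ε : Fin n → Bool, (∑ x ∈ A, (Real.exp (t * ∑ i, boolSign (ε i) * x i) +
        Real.exp (-t * ∑ i, boolSign (ε i) * x i))) ≤ 2 ^ n * k := by
    rw [Finset.sum_comm]
    calc _ ≤ ∑ _x ∈ A, 2 * (2 ^ n * Real.exp (t ^ 2 * n / 2)) := by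
          refine Finset.sum_le_sum fun x hx => ?_
          rw [Finset.sum_add_distrib]
          have h1 := sum_exp_signs_le x (hA x hx) t
          have h2 := sum_exp_signs_le x (hA x hx) (-t)
          rw [neg_sq] at h2
          linarith
      _ = A.card * (2 * (2 ^ n * Real.exp (t ^ 2 * n / 2))) := by
          rw [Finset.sum_const, nsmul_eq_mul]
      _ ≤ N * (2 * (2 ^ n * Real.exp (t ^ 2 * n / 2))) := by gcongr
      _ = 2 ^ n * k := by rw [hk]; ring
  rw [Finset.mul_sum]
  refine (Finset.sum_le_sum fun ε _ => hpt ε).trans ?_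
  rw [Finset.sum_add_distrib, ← Finset.sum_div, Finset.sum_const, Finset.card_univ,
    Fintype.card_fun, Fintype.card_bool, Fintype.card_fin, nsmul_eq_mul, ← hlog]
  have := (div_le_iff₀ hk0).2 hsum
  push_cast
  linarith

/-! ### Traces and the definability of `δ` -/

/-- The trace of the fibre `{x | (x, b) ∈ Φ}` on the tuple `c`: the set of indices `i` such that
`(c i, b) ∈ Φ`. -/
def trace {C C' ι : Type*} (Φ : Set (C × C')) (c : ι → C) (b : C') : Set ι :=
  {i | (c i, b) ∈ Φ}

open Classical in
theorem Fr_eq_sum {C : Type*} (P : Set C) {n : ℕ} (a : Fin n → C) :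
    Fr P a = (∑ i, if a i ∈ P then 1 else 0) / n := by
  unfold Fr
  rw [Finset.sum_boole, Set.ncard_eq_toFinset_card']
  congr 3
  ext; simp

/-- The difference, in absolute value, between the proportions of the two copies of `Fin n` that a
set of indices occupies. -/
noncomputable def halfDiscrepancy {n : ℕ} (t : Set (Fin n ⊕ Fin n)) : ℝ :=
  |(Set.ncard {i : Fin n | Sum.inl i ∈ t} : ℝ) / n -
    (Set.ncard {i : Fin n | Sum.inr i ∈ t} : ℝ) / n|

theorem delta_eq_sSup {C C' : Type*} (Φ : Set (C × C')) {n : ℕ} (c : Fin n ⊕ Fin n → C) :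
    delta Φ (fun i => c (Sum.inl i)) (fun i => c (Sum.inr i)) =
      sSup (halfDiscrepancy '' Set.range (trace Φ c)) := by
  rw [← Set.range_comp]
  rfl

/-- The supremum in the definition of `delta` is attained, since there are finitely many traces. -/
theorem exists_delta_eq {C C' : Type*} [Nonempty C'] (Φ : Set (C × C')) {n : ℕ}
    (c : Fin n ⊕ Fin n → C) :
    ∃ b, delta Φ (fun i => c (Sum.inl i)) (fun i => c (Sum.inr i)) =
      delta₀ Φ (fun i => c (Sum.inl i)) (fun i => c (Sum.inr i)) b := by
  have h := Set.Nonempty.csSup_mem (s := halfDiscrepancy '' Set.range (trace Φ c))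
    ((Set.range_nonempty _).image _) (Set.toFinite _)
  rw [← delta_eq_sSup] at h
  obtain ⟨_, ⟨b, rfl⟩, hb⟩ := h
  exact ⟨b, hb.symm⟩

namespace EqSort

variable {L : FirstOrder.Language.{u, v}} {U : Type w} [L.Structure U] {S S' : EqSort L U}

theorem exists_cls (S : EqSort L U) (b : S.Carrier) : ∃ v, S.cls v = b := Quotient.exists_rep b

theorem isDefinable_mem_range_trace {A : Set U} {Φ : Set (S.Carrier × S'.Carrier)}
    (hΦ : EqSort.IsDefinable₂ S S' A Φ) {ι : Type} [Finite ι] (t : Set ι) :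
    S.IsDefinable A {c : ι → S.Carrier | t ∈ Set.range (trace Φ c)} := by
  classical
  let D : Set ((ι × Fin S.arity) ⊕ Fin S'.arity → U) :=
    ⋂ i, {v | ((S.cls fun j => v (Sum.inl (i, j)), S'.cls fun j => v (Sum.inr j)) ∈ Φ) ↔ i ∈ t}
  have hD : A.Definable L D := by
    refine Set.definable_iInter_of_finite fun i => ?_
    have h := Set.Definable.preimage_comp
      (Sum.map (fun j => (i, j)) id : Fin S.arity ⊕ Fin S'.arity → (ι × Fin S.arity) ⊕ Fin S'.arity)
      hΦ
    by_cases hi : i ∈ t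
    · convert! h using 1
      ext v; simp [hi]
    · convert! h.compl using 1
      ext v; simp [hi]
  have h := Set.Definable.exists_of_finite hD
  unfold IsDefinable
  convert! h using 1
  ext v
  simp only [Set.mem_ofPred_eq, Set.mem_range, D, Set.mem_iInter, Sum.elim_inl, Sum.elim_inr]
  constructor
  · rintro ⟨b, rfl⟩
    obtain ⟨w, rfl⟩ := S'.exists_cls b
    exact ⟨w, fun i => Iff.rfl⟩
  · rintro ⟨w, hw⟩
    exact ⟨S'.cls w, Set.ext hw⟩

theorem isDefinable_range_trace_eq {A : Set U} {Φ : Set (S.Carrier × S'.Carrier)}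
    (hΦ : EqSort.IsDefinable₂ S S' A Φ) {ι : Type} [Finite ι] (W : Set (Set ι)) :
    S.IsDefinable A {c : ι → S.Carrier | Set.range (trace Φ c) = W} := by
  have h : ∀ t : Set ι, S.IsDefinable A
      {c : ι → S.Carrier | t ∈ Set.range (trace Φ c) ↔ t ∈ W} := fun t => by
    by_cases ht : t ∈ W
    · simpa [ht] using isDefinable_mem_range_trace hΦ t
    · have := Set.Definable.compl (isDefinable_mem_range_trace hΦ t)
      unfold IsDefinable
      convert! this using 1
      ext v; simp [ht]
  have h' := Set.definable_iInter_of_finite h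
  unfold IsDefinable
  convert! h' using 1
  ext v
  simp [Set.ext_iff]

end EqSort

theorem KeislerMeasure.exists_hasExpectation_delta {L : FirstOrder.Language.{u, v}} {U : Type w}
    [L.Structure U] {S S' : EqSort L U} {A : Set U} {Φ : Set (S.Carrier × S'.Carrier)}
    (hΦ : EqSort.IsDefinable₂ S S' A Φ) {n : ℕ} (μ : KeislerMeasure S (Fin n ⊕ Fin n)) :
    ∃ e, μ.HasExpectation
      (fun c => delta Φ (fun i => c (Sum.inl i)) (fun i => c (Sum.inr i))) e := by
  simp_rw [delta_eq_sSup]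
  refine ⟨_, ?_, ?_, rfl⟩
  · refine (Set.toFinite (Set.range fun W : Set (Set (Fin n ⊕ Fin n)) =>
      sSup (halfDiscrepancy '' W))).subset ?_
    rintro _ ⟨c, rfl⟩
    exact ⟨_, rfl⟩
  · intro r
    have h := EqSort.isDefinable_mem_finset
      (fun W => (EqSort.isDefinable_range_trace_eq hΦ W).mono (Set.subset_univ A))
      (Set.toFinite {W : Set (Set (Fin n ⊕ Fin n)) | sSup (halfDiscrepancy '' W) = r}).toFinset
    simpa using h

/-! ### NIP bounds the number of traces -/

/-- In a model of a NIP theory, the sets shattered by the fibres of a relation definable with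
parameters have bounded size. -/
theorem exists_card_lt_of_shattered {L : FirstOrder.Language.{u, v}} {T : L.Theory}
    (hNIP : Theory.IsNIP.{u, v, w} T) {U : Type w} [L.Structure U] [Nonempty U] [U ⊨ T]
    {A : Set U} {m k : ℕ} {D : Set (Fin m ⊕ Fin k → U)} (hD : A.Definable L D) :
    ∃ d : ℕ, ∀ F : Finset (Fin m → U),
      (∀ B ⊆ F, ∃ b : Fin k → U, ∀ a ∈ F, a ∈ B ↔ Sum.elim a b ∈ D) → F.card < d := by
  classical
  obtain ⟨A₀, -, hA₀⟩ := Set.definable_iff_finitely_definable.1 hD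
  obtain ⟨φ, hφ⟩ := Set.definable_iff_exists_formula_sum.1 hA₀
  -- the finitely many parameters are treated as further variables on the side of `y`
  let e : (A₀ : Set U) ≃ Fin A₀.card := A₀.equivFin
  let ρ : (A₀ : Set U) ⊕ (Fin m ⊕ Fin k) → Fin m ⊕ Fin (A₀.card + k) :=
    Sum.elim (fun a => Sum.inr (Fin.castAdd k (e a)))
      (Sum.elim Sum.inl fun j => Sum.inr (Fin.natAdd A₀.card j))
  by_contra hcon
  push Not at hcon
  refine hNIP ⟨m, A₀.card + k, φ.relabel ρ, fun n => ?_⟩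
  obtain ⟨F, hF, hn⟩ := hcon n
  refine ⟨Theory.ModelType.of T U, F, hn, fun B hB => ?_⟩
  obtain ⟨b, hb⟩ := hF B hB
  have key : ∀ a : Fin m → U, Sum.elim a b ∈ D ↔
      (φ.relabel ρ).Realize (Sum.elim a (Fin.append (fun i => (e.symm i : U)) b)) := fun a => by
    rw [hφ, Formula.realize_relabel]
    refine iff_of_eq (congrArg φ.Realize ?_)
    funext x
    rcases x with x | x | x <;> simp [ρ]
  exact ⟨Fin.append (fun i => (e.symm i : U)) b, fun a ha => (hb a ha).trans (key a)⟩

/-- The systems of traces of a definable relation on finite tuples have bounded VC dimension. -/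
theorem EqSort.exists_vcDim_le {L : FirstOrder.Language.{u, v}} {T : L.Theory}
    (hNIP : Theory.IsNIP.{u, v, w} T) {U : Type w} [L.Structure U] [Nonempty U] [U ⊨ T]
    {S S' : EqSort L U} {A : Set U} {Φ : Set (S.Carrier × S'.Carrier)}
    (hΦ : EqSort.IsDefinable₂ S S' A Φ) :
    ∃ d : ℕ, ∀ {ι : Type} [DecidableEq ι] (c : ι → S.Carrier) (𝒜 : Finset (Finset ι)),
      (∀ t ∈ 𝒜, ∃ b, (t : Set ι) = trace Φ c b) → 𝒜.vcDim ≤ d := by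
  classical
  obtain ⟨d, hd⟩ := exists_card_lt_of_shattered hNIP hΦ
  refine ⟨d, fun {ι} _ c 𝒜 h𝒜 => Finset.sup_le fun s hs => ?_⟩
  replace hs : ∀ B ⊆ s, ∃ b, ∀ i ∈ s, i ∈ B ↔ (c i, b) ∈ Φ := fun B hB => by
    obtain ⟨t, ht, rfl⟩ := Finset.mem_shatterer.1 hs hB
    obtain ⟨b, hb⟩ := h𝒜 t ht
    refine ⟨b, fun i hi => ?_⟩
    have : i ∈ (t : Set ι) ↔ i ∈ trace Φ c b := by rw [hb]
    simpa [hi, trace] using this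
  choose r hr using fun i => S.exists_cls (c i)
  -- a shattered set of indices carries distinct elements
  have hinj : Set.InjOn r s := fun i hi j hj hij => by
    obtain ⟨b, hb⟩ := hs {i} (by simpa using hi)
    have h1 := (hb i hi).1 (by simp)
    rw [← hr i, hij, hr j] at h1
    exact (Finset.mem_singleton.1 ((hb j hj).2 h1)).symm
  rw [← Finset.card_image_of_injOn hinj]
  refine (hd _ fun B _ => ?_).le
  obtain ⟨b, hb⟩ := hs (s.filter fun i => r i ∈ B) (Finset.filter_subset _ _)
  obtain ⟨w, rfl⟩ := S'.exists_cls b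
  refine ⟨w, fun a ha => ?_⟩
  obtain ⟨i, hi, rfl⟩ := Finset.mem_image.1 ha
  have := hb i hi
  rw [← hr i] at this
  simpa [hi] using this

/-- A polynomial form of the Sauer–Shelah lemma. -/
theorem Finset.card_le_of_vcDim_le {ι : Type*} [Fintype ι] [DecidableEq ι] {d : ℕ}
    {𝒜 : Finset (Finset ι)} (h : 𝒜.vcDim ≤ d) :
    𝒜.card ≤ (d + 1) * (Fintype.card ι + 1) ^ d := by
  refine 𝒜.card_le_card_shatterer.trans (Finset.card_shatterer_le_sum_vcDim.trans ?_)
  calc ∑ k ∈ Finset.Iic 𝒜.vcDim, (Fintype.card ι).choose k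
      ≤ ∑ k ∈ Finset.Iic d, (Fintype.card ι).choose k :=
        Finset.sum_le_sum_of_subset (Finset.Iic_subset_Iic.2 h)
    _ ≤ ∑ _k ∈ Finset.Iic d, (Fintype.card ι + 1) ^ d := by
        refine Finset.sum_le_sum fun k hk => (Nat.choose_le_pow _ _).trans ?_
        exact (Nat.pow_le_pow_left (Nat.le_succ _) k).trans
          (Nat.pow_le_pow_right (Nat.succ_pos _) (Finset.mem_Iic.1 hk))
    _ = _ := by simp

/-! ### Symmetrization and the limit -/

/-- The permutation of the `2n` variables that exchanges `x_i` and `x'_i` for each `i` with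
`ε i = false`. -/
def swapPerm {n : ℕ} (ε : Fin n → Bool) : Equiv.Perm (Fin n ⊕ Fin n) :=
  Function.Involutive.toPerm
    (Sum.elim (fun i => if ε i then Sum.inl i else Sum.inr i)
      fun i => if ε i then Sum.inr i else Sum.inl i)
    (by rintro (i | i) <;> by_cases h : ε i <;> simp [h])

theorem swapPerm_inl {n : ℕ} (ε : Fin n → Bool) (i : Fin n) :
    swapPerm ε (Sum.inl i) = if ε i then Sum.inl i else Sum.inr i := rfl

theorem swapPerm_inr {n : ℕ} (ε : Fin n → Bool) (i : Fin n) :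
    swapPerm ε (Sum.inr i) = if ε i then Sum.inr i else Sum.inl i := rfl

open Classical in
theorem delta₀_swapPerm {C C' : Type*} (Φ : Set (C × C')) {n : ℕ} (c : Fin n ⊕ Fin n → C) (b : C')
    (ε : Fin n → Bool) :
    delta₀ Φ (fun i => c (swapPerm ε (Sum.inl i))) (fun i => c (swapPerm ε (Sum.inr i))) b =
      |∑ i, boolSign (ε i) * ((if Sum.inl i ∈ trace Φ c b then 1 else 0) -
        if Sum.inr i ∈ trace Φ c b then 1 else 0)| / n := by
  unfold delta₀
  rw [Fr_eq_sum, Fr_eq_sum, ← sub_div, abs_div, Nat.abs_cast, ← Finset.sum_sub_distrib]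
  congr 3 with i
  by_cases h : ε i <;> simp [h, swapPerm_inl, swapPerm_inr, boolSign, trace] <;> congr

/-- The sum of `δ` over all exchanges of the two halves of a fixed tuple. The vectors to which the
maximal inequality is applied are the differences `x_i = 1_{φ(c_i, b)} - 1_{φ(c'_i, b)}`, one for
each trace. -/
theorem sum_delta_swapPerm_le {C C' : Type*} [Nonempty C'] (Φ : Set (C × C')) {d n : ℕ} (hn : 0 < n)
    (c : Fin n ⊕ Fin n → C)
    (hd : ∀ 𝒜 : Finset (Finset (Fin n ⊕ Fin n)),
      (∀ t ∈ 𝒜, ∃ b, (t : Set (Fin n ⊕ Fin n)) = trace Φ c b) → 𝒜.vcDim ≤ d)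
    {t : ℝ} (ht : 0 < t) :
    ∑ ε : Fin n → Bool, delta Φ (fun i => c (swapPerm ε (Sum.inl i)))
        (fun i => c (swapPerm ε (Sum.inr i))) ≤
      2 ^ n * (Real.log (2 * ((d + 1) * (2 * n + 1) ^ d)) / (t * n) + t / 2) := by
  classical
  let 𝒜 : Finset (Finset (Fin n ⊕ Fin n)) :=
    Finset.univ.filter fun s => ∃ b, (s : Set (Fin n ⊕ Fin n)) = trace Φ c b
  have hcard := Finset.card_le_of_vcDim_le (hd 𝒜 fun s hs => (Finset.mem_filter.1 hs).2)
  let x : Finset (Fin n ⊕ Fin n) → Fin n → ℝ := fun s i =>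
    (if Sum.inl i ∈ s then 1 else 0) - if Sum.inr i ∈ s then 1 else 0
  have hn' : (0 : ℝ) < n := by exact_mod_cast hn
  have key := sum_max_signs_le (𝒜.image x) (N := (d + 1) * (2 * n + 1) ^ d)
    (by
      intro y hy i
      obtain ⟨s, -, rfl⟩ := Finset.mem_image.1 hy
      simp only [x]
      split_ifs <;> simp)
    (by positivity)
    (by
      have := (Finset.card_image_le (f := x)).trans hcard
      rw [Fintype.card_sum, Fintype.card_fin, ← two_mul] at this
      exact_mod_cast this)
    (fun ε => n * delta Φ (fun i => c (swapPerm ε (Sum.inl i)))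
        (fun i => c (swapPerm ε (Sum.inr i))))
    (by
      intro ε
      obtain ⟨b, hb⟩ := exists_delta_eq Φ fun i => c (swapPerm ε i)
      refine ⟨x (Set.toFinite (trace Φ c b)).toFinset,
        Finset.mem_image_of_mem _ (Finset.mem_filter.2 ⟨Finset.mem_univ _, b, by simp⟩), ?_⟩
      rw [hb, delta₀_swapPerm, mul_div_cancel₀ _ hn'.ne']
      simp [x])
    ht
  rw [← Finset.mul_sum] at key
  have h : Real.log (2 * ((d + 1) * (2 * n + 1) ^ d)) / (t * n) + t / 2 =
      (Real.log (2 * ((d + 1) * (2 * n + 1) ^ d)) + t ^ 2 * n / 2) / (t * n) := by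
    field_simp
  rw [h, ← mul_div_assoc, le_div_iff₀ (by positivity)]
  linarith

theorem tendsto_log_polynomial_div (d : ℕ) :
    Filter.Tendsto (fun n : ℕ => Real.log (2 * ((d + 1) * (2 * n + 1) ^ d)) / n)
      Filter.atTop (nhds 0) := by
  have h1 : Filter.Tendsto (fun n : ℕ => Real.log (n : ℝ) / n) Filter.atTop (nhds 0) :=
    (Real.isLittleO_log_id_atTop.tendsto_div_nhds_zero).comp tendsto_natCast_atTop_atTop
  have h2 : Filter.Tendsto (fun n : ℕ => (Real.log (2 * (d + 1)) + d * Real.log 3) / (n : ℝ) +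
      d * (Real.log (n : ℝ) / n)) Filter.atTop (nhds 0) := by
    simpa using (tendsto_const_div_atTop_nhds_zero_nat _).add (h1.const_mul (d : ℝ))
  refine squeeze_zero' (Filter.Eventually.of_forall fun n => ?_) ?_ h2
  · refine div_nonneg (Real.log_nonneg ?_) n.cast_nonneg
    have : (1 : ℝ) ≤ (2 * n + 1) ^ d := one_le_pow₀ (by linarith [n.cast_nonneg (α := ℝ)])
    nlinarith [d.cast_nonneg (α := ℝ)]
  · filter_upwards [Filter.eventually_gt_atTop 0] with n hn
    have hn' : (1 : ℝ) ≤ n := by exact_mod_cast hn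
    rw [← mul_div_assoc, ← add_div]
    refine div_le_div_of_nonneg_right ?_ n.cast_nonneg
    rw [← mul_assoc, Real.log_mul (by positivity) (by positivity), Real.log_pow, add_assoc,
      ← mul_add, ← Real.log_mul (by norm_num) (by positivity)]
    gcongr
    linarith

theorem lemma3p4 {L : FirstOrder.Language.{u, v}} (T : L.Theory) (hT : T.IsComplete)
    (hNIP : Theory.IsNIP.{u, v, w} T)
    -- the monster model `U` of `T`, and a small model `M`
    (U : Type w) [L.Structure U] [Nonempty U] [U ⊨ T]
    (κ : Cardinal.{w}) (hU : IsMonsterModel L U κ)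
    (M : L.ElementarySubstructure U) (hM : Cardinal.mk M < κ)
    -- definable sets `X`, `Y` in sorts `S`, `S'`, and a formula `φ(x, y) ⊆ X × Y` over `M`
    (S S' : EqSort L U)
    (X : Set S.Carrier) (hX : S.IsDefinable₁ Set.univ X)
    (Y : Set S'.Carrier) (hY : S'.IsDefinable₁ Set.univ Y)
    (Φ : Set (S.Carrier × S'.Carrier)) (hΦ : EqSort.IsDefinable₂ S S' (M : Set U) Φ)
    (hΦXY : Φ ⊆ X ×ˢ Y)
    -- for `n > 0`, a symmetric `M`-invariant global measure on `X^{2n}`, whose variables are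
    -- `(x_1, …, x_n, x'_1, …, x'_n)`
    (μ : ∀ n : ℕ, KeislerMeasure S (Fin n ⊕ Fin n))
    (hsymm : ∀ n : ℕ, 0 < n → (μ n).IsSymmetricOn X hX)
    (hinv : ∀ n : ℕ, 0 < n → (μ n).IsInvariant (M : Set U)) :
    ∃ E : ℕ → ℝ,
      (∀ n : ℕ, 0 < n → (μ n).HasExpectation
        (fun c => delta Φ (fun i => c (Sum.inl i)) (fun i => c (Sum.inr i))) (E n)) ∧
      Filter.Tendsto E Filter.atTop (nhds 0) := by
  choose E hE using fun n => (μ n).exists_hasExpectation_delta hΦ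
  refine ⟨E, fun n _ => hE n, ?_⟩
  obtain ⟨d, hd⟩ := EqSort.exists_vcDim_le hNIP hΦ
  have : Nonempty S'.Carrier := ⟨S'.cls fun _ => Classical.arbitrary U⟩
  have hbound : ∀ t : ℝ, 0 < t → ∀ n : ℕ, 0 < n →
      E n ≤ Real.log (2 * ((d + 1) * (2 * n + 1) ^ d)) / (t * n) + t / 2 := by
    intro t ht n hn
    refine (hE n).le_of_average_le (hsymm n hn).2 swapPerm fun c => ?_
    simpa using sum_delta_swapPerm_le Φ hn c (hd c) ht
  -- on the finite sum that defines `E n`, each value `r` of `δ` is nonnegative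
  have hnonneg : ∀ n, 0 ≤ E n := fun n => by
    obtain ⟨hfin, hdef, h⟩ := hE n
    rw [h]
    refine Finset.sum_nonneg fun r hr => mul_nonneg ?_ ((μ n).nonneg _)
    obtain ⟨c, rfl⟩ := by simpa using hr
    exact Real.iSup_nonneg fun b => abs_nonneg _
  refine Metric.tendsto_atTop'.2 fun ε hε => ?_
  have hlim := (tendsto_log_polynomial_div d).eventually_lt_const
    (show (0 : ℝ) < ε * (ε / 2) by positivity)
  obtain ⟨n₀, hn₀⟩ := Filter.eventually_atTop.1 hlim
  refine ⟨n₀, fun n hn => ?_⟩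
  have hn0 : 0 < n := by omega
  rw [Real.dist_0_eq_abs, abs_of_nonneg (hnonneg n)]
  refine (hbound ε hε n hn0).trans_lt ?_
  -- the free parameter of the bound is taken to be `ε`, so that its second term is `ε / 2`
  have h1 := hn₀ n hn.le
  rw [← div_lt_iff₀' hε, div_div, mul_comm (n : ℝ)] at h1
  linarith
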